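/- Let $0<k<n$ be integers. Let $\operatorname{Gr}(k,n)$ be the set of $k$-dimensional linear subspaces of $\mathbb{R}^n$, and let $\operatorname{Graff}(k,n)$ be the set of $k$-dimensional affine subspaces $\mathbb{A}+b$ of $\mathbb{R}^n$ ($\mathbb{A}\in\operatorname{Gr}(k,n)$, $b\in\mathbb{R}^n$). The Grassmann distance on $\operatorname{Gr}(k,n)$ is $$d_{\operatorname{Gr}(k,n)}(\mathbb{A},\mathbb{B})=\Bigl(\sum_{i=1}^{k}\theta_i^2\Bigr)^{1/2},$$ where $\theta_1,\dots,\theta_k\in[0,\pi/2]$ are the principal angles between $\mathbb{A}$ and $\mathbb{B}$: recursively, $\theta_i$ is the angle between $p_i$ and $q_i$, where $(p_i,q_i)$ maximizes $\langle p,q\rangle$ over all unit vectors $p\in\mathbb{A}$, $q\in\mathbb{B}$ with $p\perp p_1,\dots,p_{i-1}$ and $q\perp q_1,\dots,q_{i-1}$. Embed $\mathbb{R}^n$ in $\mathbb{R}^{n+1}$ by $x\mapsto(x,0)$, let $e_{n+1}=(0,\dots,0,1)^{\mathsf T}$, and let $$j:\operatorname{Graff}(k,n)\to\operatorname{Gr}(k+1,n+1),\qquad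 j(\mathbb{A}+b)=\operatorname{span}\bigl(\mathbb{A}\cup\{b+e_{n+1}\}\bigr).$$ Put $$d_{\operatorname{Graff}(k,n)}(\mathbb{A}+b,\mathbb{B}+c):=d_{\operatorname{Gr}(k+1,n+1)}\bigl(j(\mathbb{A}+b),j(\mathbb{B}+c)\bigr).$$ Then the following hold. 1. $d_{\operatorname{Graff}(k,n)}$ is a distance on $\operatorname{Graff}(k,n)$: it is nonnegative, it vanishes exactly when the two flats are equal, it is symmetric, and it satisfies the triangle inequality. 2. It is consistent with the Grassmann distance: for linear subspaces $\mathbb{A},\mathbb{B}\in\operatorname{Gr}(k,n)$, regarded as $k$-flats, $d_{\operatorname{Graff}(k,n)}(\mathbb{A},\mathbb{B})=d_{\operatorname{Gr}(k,n)}(\mathbb{A},\mathbb{B})$. 3. Let $\mathbb{A}+b,\mathbb{B}+c\in\operatorname{Graff}(k,n)$. Let $A,B\in\mathbb{R}^{n\times k}$ have orthonormal columns spanning $\mathbb{A}$ and $\mathbb{B}$ respectively, and let $b_0,c_0\in\mathbb{R}^n$ satisfy $A^{\mathsf T}b_0=0$, $\mathbb{A}+b_0=\mathbb{A}+b$, $B^{\mathsf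 T}c_0=0$, $\mathbb{B}+c_0=\mathbb{B}+c$. With the matrices of Stiefel coordinates $$Y_{\mathbb{A}+b}=\begin{bmatrix}A& b_0/\sqrt{1+\lVert b_0\rVert^2}\\ 0&1/\sqrt{1+\lVert b_0\rVert^2}\end{bmatrix},\qquad Y_{\mathbb{B}+c}=\begin{bmatrix}B& c_0/\sqrt{1+\lVert c_0\rVert^2}\\ 0&1/\sqrt{1+\lVert c_0\rVert^2}\end{bmatrix},$$ one has $$d_{\operatorname{Graff}(k,n)}(\mathbb{A}+b,\mathbb{B}+c)=\Bigl(\sum_{i=1}^{k+1}\theta_i^2\Bigr)^{1/2},\qquad \theta_i=\arccos\sigma_i,$$ where $\sigma_1,\dots,\sigma_{k+1}$ are the singular values of $Y_{\mathbb{A}+b}^{\mathsf T}Y_{\mathbb{B}+c}\in\mathbb{R}^{(k+1)\times(k+1)}$. -/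

import Mathlib

open scoped RealInnerProductSpace

namespace AffineGrassmannian

/-! ### Principal vectors and principal angles -/

section Principal

variable {E : Type*} [NormedAddCommGroup E] [InnerProductSpace ℝ E]

/-- `p 0, …, p (m-1)` and `q 0, …, q (m-1)` are the first `m` pairs of principal vectors of the
subspaces `A` and `B`: recursively, `(p i, q i)` maximizes `⟪a, b⟫` among all unit vectors `a ∈ A`
and `b ∈ B` with `a` orthogonal to `p 0, …, p (i-1)` and `b` orthogonal to `q 0, …, q (i-1)`. -/
structure IsPrincipalVectors (A B : Submodule ℝ E) {m : ℕ} (p q : Fin m → E) : Prop where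
  left_mem : ∀ i, p i ∈ A
  right_mem : ∀ i, q i ∈ B
  left_norm : ∀ i, ‖p i‖ = 1
  right_norm : ∀ i, ‖q i‖ = 1
  left_orth : ∀ i l, l < i → ⟪p l, p i⟫ = 0
  right_orth : ∀ i l, l < i → ⟪q l, q i⟫ = 0
  maximal : ∀ i, ∀ a ∈ A, ∀ b ∈ B, ‖a‖ = 1 → ‖b‖ = 1 →
    (∀ l < i, ⟪p l, a⟫ = 0) → (∀ l < i, ⟪q l, b⟫ = 0) → ⟪a, b⟫ ≤ ⟪p i, q i⟫

/-- A subspace of dimension larger than `m` has a unit vector orthogonal to `m` given vectors. -/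
theorem exists_unit_orthogonal (A : Submodule ℝ E) [FiniteDimensional ℝ A] {m : ℕ}
    (hm : m < Module.finrank ℝ A) (p : Fin m → E) :
    ∃ a ∈ A, ‖a‖ = 1 ∧ ∀ l, ⟪p l, a⟫ = 0 := by
  let f : A →ₗ[ℝ] (Fin m → ℝ) :=
    LinearMap.pi fun l => (innerₛₗ ℝ (p l)).comp A.subtype
  have hker : LinearMap.ker f ≠ ⊥ := by
    apply LinearMap.ker_ne_bot_of_finrank_lt
    simpa using hm
  obtain ⟨x, hx, hx0⟩ := (Submodule.ne_bot_iff _).1 hker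
  have hx0' : (x : E) ≠ 0 := by simpa using hx0
  have hfx : ∀ l, ⟪p l, (x : E)⟫ = 0 := fun l => by
    have := congrFun (LinearMap.mem_ker.1 hx) l
    simpa [f] using this
  refine ⟨(‖(x : E)‖⁻¹ : ℝ) • (x : E), A.smul_mem _ x.2, ?_, fun l => ?_⟩
  · rw [norm_smul, norm_inv, norm_norm]
    exact inv_mul_cancel₀ (norm_ne_zero_iff.2 hx0')
  · rw [inner_smul_right, hfx, mul_zero]

/-- Principal vectors exist. -/
theorem exists_isPrincipalVectors (A B : Submodule ℝ E) [FiniteDimensional ℝ A]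
    [FiniteDimensional ℝ B] (m : ℕ) (hA : m ≤ Module.finrank ℝ A)
    (hB : m ≤ Module.finrank ℝ B) :
    ∃ p q : Fin m → E, IsPrincipalVectors A B p q := by
  induction m with
  | zero =>
    exact ⟨fun i => i.elim0, fun i => i.elim0, ⟨fun i => i.elim0, fun i => i.elim0,
      fun i => i.elim0, fun i => i.elim0, fun i => i.elim0, fun i => i.elim0,
      fun i => i.elim0⟩⟩
  | succ m ih =>
    obtain ⟨p, q, h⟩ := ih (by omega) (by omega)
    let K : (C : Submodule ℝ E) → (Fin m → E) → Set C := fun C r =>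
      Metric.sphere (0 : C) 1 ∩ {x | ∀ l, ⟪r l, (x : E)⟫ = 0}
    have hK : ∀ (C : Submodule ℝ E) [FiniteDimensional ℝ C] (r : Fin m → E),
        IsCompact (K C r) := by
      intro C _ r
      refine (isCompact_sphere (0 : C) 1).inter_right ?_
      simp only [Set.ofPred_forall]
      refine isClosed_iInter fun l => isClosed_eq ?_ continuous_const
      fun_prop
    obtain ⟨a₀, ha₀, ha₀n, ha₀o⟩ := exists_unit_orthogonal A (by omega) p
    obtain ⟨b₀, hb₀, hb₀n, hb₀o⟩ := exists_unit_orthogonal B (by omega) q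
    obtain ⟨⟨a, b⟩, ⟨ha, hb⟩, hmax⟩ := ((hK A p).prod (hK B q)).exists_isMaxOn
      (f := fun x : A × B => ⟪(x.1 : E), (x.2 : E)⟫)
      ⟨(⟨a₀, ha₀⟩, ⟨b₀, hb₀⟩), by simpa [K, ha₀n] using ha₀o, by simpa [K, hb₀n] using hb₀o⟩
      (by fun_prop)
    have han : ‖(a : E)‖ = 1 := by simpa using ha.1
    have hbn : ‖(b : E)‖ = 1 := by simpa using hb.1
    have hcs : ∀ (i l : Fin m), l.castSucc < i.castSucc ↔ l < i := fun i l => Iff.rfl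
    refine ⟨Fin.snoc (α := fun _ => E) p a, Fin.snoc (α := fun _ => E) q b,
      ⟨?_, ?_, ?_, ?_, ?_, ?_, ?_⟩⟩
    · intro i; refine Fin.lastCases ?_ (fun i => ?_) i
      · simp
      · simpa using h.left_mem i
    · intro i; refine Fin.lastCases ?_ (fun i => ?_) i
      · simp
      · simpa using h.right_mem i
    · intro i; refine Fin.lastCases ?_ (fun i => ?_) i
      · simpa using han
      · simpa using h.left_norm i
    · intro i; refine Fin.lastCases ?_ (fun i => ?_) i
      · simpa using hbn
      · simpa using h.right_norm i
    · intro i l hl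
      induction l using Fin.lastCases with
      | last => exact absurd hl (Fin.le_last i).not_gt
      | cast l =>
        induction i using Fin.lastCases with
        | last => simpa using ha.2 l
        | cast i => simpa using h.left_orth i l hl
    · intro i l hl
      induction l using Fin.lastCases with
      | last => exact absurd hl (Fin.le_last i).not_gt
      | cast l =>
        induction i using Fin.lastCases with
        | last => simpa using hb.2 l
        | cast i => simpa using h.right_orth i l hl
    · intro i x hx y hy hxn hyn hxo hyo
      induction i using Fin.lastCases with
      | last =>
        have h1 : ∀ l, ⟪p l, x⟫ = 0 := fun l => by
          simpa using hxo l.castSucc (Fin.castSucc_lt_last l)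
        have h2 : ∀ l, ⟪q l, y⟫ = 0 := fun l => by
          simpa using hyo l.castSucc (Fin.castSucc_lt_last l)
        have := hmax (a := ((⟨x, hx⟩ : A), (⟨y, hy⟩ : B)))
          ⟨by simpa [K, hxn] using h1, by simpa [K, hyn] using h2⟩
        simpa using this
      | cast i =>
        have := h.maximal i x hx y hy hxn hyn
          (fun l hl => by simpa using hxo l.castSucc hl)
          (fun l hl => by simpa using hyo l.castSucc hl)
        simpa using this

namespace IsPrincipalVectors

variable {A B : Submodule ℝ E} {m : ℕ} {p q : Fin m → E}

theorem symm (h : IsPrincipalVectors A B p q) : IsPrincipalVectors B A q p where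
  left_mem := h.right_mem
  right_mem := h.left_mem
  left_norm := h.right_norm
  right_norm := h.left_norm
  left_orth := h.right_orth
  right_orth := h.left_orth
  maximal i a ha b hb han hbn hao hbo := by
    rw [real_inner_comm, real_inner_comm (p i)]
    exact h.maximal i b hb a ha hbn han hbo hao

theorem inner_le (h : IsPrincipalVectors A B p q) (i : Fin m) {a b : E} (ha : a ∈ A) (hb : b ∈ B)
    (hao : ∀ l < i, ⟪p l, a⟫ = 0) (hbo : ∀ l < i, ⟪q l, b⟫ = 0) :
    ⟪a, b⟫ ≤ ⟪p i, q i⟫ * (‖a‖ * ‖b‖) := by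
  rcases eq_or_ne a 0 with rfl | ha0
  · simp
  rcases eq_or_ne b 0 with rfl | hb0
  · simp
  have ha' := norm_pos_iff.2 ha0
  have hb' := norm_pos_iff.2 hb0
  have := h.maximal i (‖a‖⁻¹ • a) (A.smul_mem _ ha) (‖b‖⁻¹ • b) (B.smul_mem _ hb)
    (by rw [norm_smul, norm_inv, norm_norm, inv_mul_cancel₀ ha'.ne'])
    (by rw [norm_smul, norm_inv, norm_norm, inv_mul_cancel₀ hb'.ne'])
    (fun l hl => by rw [inner_smul_right, hao l hl, mul_zero])
    (fun l hl => by rw [inner_smul_right, hbo l hl, mul_zero])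
  rw [real_inner_smul_left, real_inner_smul_right] at this
  calc ⟪a, b⟫ = (‖a‖⁻¹ * (‖b‖⁻¹ * ⟪a, b⟫)) * (‖a‖ * ‖b‖) := by field_simp
    _ ≤ _ := by gcongr

theorem inner_nonneg (h : IsPrincipalVectors A B p q) (i : Fin m) : 0 ≤ ⟪p i, q i⟫ := by
  have := h.inner_le i (A.neg_mem (h.left_mem i)) (h.right_mem i)
    (fun l hl => by rw [inner_neg_right, h.left_orth i l hl, neg_zero]) (h.right_orth i)
  rw [norm_neg, h.left_norm, h.right_norm, inner_neg_left] at this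
  linarith

theorem inner_eq_zero (h : IsPrincipalVectors A B p q) (i : Fin m) {a : E} (ha : a ∈ A)
    (hao : ∀ l ≤ i, ⟪p l, a⟫ = 0) : ⟪a, q i⟫ = 0 := by
  have h0 := h.inner_nonneg i
  set σ := ⟪p i, q i⟫ with hσ
  set s := ⟪a, q i⟫ with hs
  set N := ‖a‖ ^ 2 with hN
  have hN0 : 0 ≤ N := sq_nonneg _
  have hd : 0 < σ * N + 1 := by positivity
  set t := (σ * N + 1)⁻¹ with ht
  have ht0 : 0 < t := inv_pos.2 hd
  have htd : t * (σ * N + 1) = 1 := inv_mul_cancel₀ hd.ne'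
  have h1 := h.inner_le i (A.add_mem (h.left_mem i) (A.smul_mem (t * s) ha)) (h.right_mem i)
    (fun l hl => by
      rw [inner_add_right, inner_smul_right, h.left_orth i l hl, hao l hl.le]; simp)
    (h.right_orth i)
  rw [h.right_norm, mul_one, inner_add_left, real_inner_smul_left, ← hs, ← hσ] at h1
  have h2 : ‖p i + (t * s) • a‖ ^ 2 = 1 + (t * s) ^ 2 * N := by
    rw [norm_add_sq_real, inner_smul_right, hao i le_rfl, h.left_norm, norm_smul, mul_pow,
      Real.norm_eq_abs, sq_abs]
    ring
  have h3 : 0 ≤ σ + t * s * s := by nlinarith [mul_nonneg ht0.le (mul_self_nonneg s)]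
  have h4 : (σ + t * s * s) ^ 2 ≤ σ ^ 2 * (1 + (t * s) ^ 2 * N) := by
    rw [← h2, ← mul_pow]
    exact pow_le_pow_left₀ h3 h1 2
  by_contra hs0
  have hs2 : 0 < s ^ 2 := by positivity
  have h5 : t * s ^ 2 * (2 * σ + t * s ^ 2) ≤ t * s ^ 2 * (σ * (σ * N * t)) := by nlinarith
  have h6 := le_of_mul_le_mul_left h5 (by positivity)
  have h7 : σ * N * t ≤ 1 := by nlinarith
  nlinarith [mul_le_mul_of_nonneg_left h7 h0, mul_pos ht0 hs2]

theorem inner_cross (h : IsPrincipalVectors A B p q) {i l : Fin m} (hil : i ≠ l) :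
    ⟪p i, q l⟫ = 0 := by
  have key : ∀ {A B : Submodule ℝ E} {p q : Fin m → E}, IsPrincipalVectors A B p q →
      ∀ i l : Fin m, l < i → ⟪p i, q l⟫ = 0 := fun h i l hl =>
    h.inner_eq_zero l (h.left_mem i) fun r hr => h.left_orth i r (hr.trans_lt hl)
  rcases lt_or_gt_of_ne hil with hl | hl
  · rw [real_inner_comm]; exact key h.symm l i hl
  · exact key h i l hl

theorem orthonormal_left (h : IsPrincipalVectors A B p q) : Orthonormal ℝ p := by
  refine ⟨h.left_norm, fun i l hil => ?_⟩
  rcases lt_or_gt_of_ne hil with hl | hl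
  · exact h.left_orth l i hl
  · rw [real_inner_comm]; exact h.left_orth i l hl

theorem inner_anti (h : IsPrincipalVectors A B p q) {i l : Fin m} (hl : l ≤ i) :
    ⟪p i, q i⟫ ≤ ⟪p l, q l⟫ :=
  h.maximal l _ (h.left_mem i) _ (h.right_mem i) (h.left_norm i) (h.right_norm i)
    (fun r hr => h.left_orth i r (hr.trans_le hl)) (fun r hr => h.right_orth i r (hr.trans_le hl))

theorem inner_le_inner [FiniteDimensional ℝ B] {p' q' : Fin m → E}
    (h : IsPrincipalVectors A B p q) (h' : IsPrincipalVectors A B p' q') (i : Fin m) :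
    ⟪p i, q i⟫ ≤ ⟪p' i, q' i⟫ := by
  let C : Submodule ℝ E := Submodule.span ℝ (Set.range fun l : Finset.Iic i => p l)
  have hC : Module.finrank ℝ C = i + 1 := by
    have h1 := finrank_span_eq_card
      (h.orthonormal_left.linearIndependent.comp (fun l : Finset.Iic i => (l : Fin m))
        Subtype.val_injective)
    rw [Fintype.card_coe, Fin.card_Iic] at h1
    exact h1
  have : FiniteDimensional ℝ C := FiniteDimensional.span_of_finite ℝ (Set.finite_range _)
  obtain ⟨a, haC, han, hao⟩ := exists_unit_orthogonal C (m := i)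
    (by omega)
    (fun l => p' (l.castLE i.2.le))
  have hao' : ∀ l < i, ⟪p' l, a⟫ = 0 := fun l hl => hao ⟨l, hl⟩
  obtain ⟨c, rfl⟩ := (Submodule.mem_span_range_iff_exists_fun ℝ).1 haC
  set a := ∑ l, c l • p (l : Fin m) with ha
  have haA : a ∈ A := A.sum_mem fun l _ => A.smul_mem _ (h.left_mem _)
  let b := ∑ l : Finset.Iic i, c l • q (l : Fin m)
  have hbB : b ∈ B := B.sum_mem fun l _ => B.smul_mem _ (h.right_mem _)
  have hnorm : ∀ {A B : Submodule ℝ E} {p q : Fin m → E}, IsPrincipalVectors A B p q →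
      ‖∑ l : Finset.Iic i, c l • p (l : Fin m)‖ ^ 2 = ∑ l, c l ^ 2 := by
    intro A B p q h
    have ho : Orthonormal ℝ fun l : Finset.Iic i => p (l : Fin m) :=
      h.orthonormal_left.comp _ Subtype.val_injective
    rw [← real_inner_self_eq_norm_sq, ho.inner_sum]
    simp [sq]
  have hcs : ∑ l, c l ^ 2 = 1 := by rw [← hnorm h, ← ha, han, one_pow]
  have hbn : ‖b‖ = 1 := by
    have := hnorm h.symm
    rw [hcs] at this
    exact (pow_eq_one_iff_of_nonneg (norm_nonneg _) two_ne_zero).1 this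
  have hab : ⟪p i, q i⟫ ≤ ⟪a, b⟫ := by
    have h1 : ⟪a, b⟫ = ∑ l : Finset.Iic i, c l ^ 2 * ⟪p (l : Fin m), q (l : Fin m)⟫ := by
      simp only [a, b, sum_inner, inner_sum, real_inner_smul_left, real_inner_smul_right]
      refine Finset.sum_congr rfl fun l _ => ?_
      rw [Finset.sum_eq_single l]
      · ring
      · intro r _ hr
        rw [h.inner_cross (fun hh => hr (Subtype.ext hh))]; simp
      · simp
    rw [h1, ← one_mul ⟪p i, q i⟫, ← hcs, Finset.sum_mul]
    exact Finset.sum_le_sum fun l _ =>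
      mul_le_mul_of_nonneg_left (h.inner_anti (Finset.mem_Iic.1 l.2)) (sq_nonneg _)
  let y : E := B.starProjection a
  have hyB : y ∈ B := B.starProjection_apply_mem a
  have hy : ∀ z ∈ B, ⟪y, z⟫ = ⟪a, z⟫ := fun z hz => by
    have := B.starProjection_inner_eq_zero a z hz
    rw [inner_sub_left] at this
    simp only [y]; linarith
  have hyo : ∀ l < i, ⟪q' l, y⟫ = 0 := fun l hl => by
    rw [real_inner_comm, hy _ (h'.right_mem l)]
    exact h'.inner_eq_zero l haA fun r hr => hao' r (hr.trans_lt hl)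
  have h1 := h'.inner_le i haA hyB hao' hyo
  rw [← hy y hyB, real_inner_self_eq_norm_sq, han, one_mul] at h1
  have h2 : ⟪p i, q i⟫ ≤ ‖y‖ := by
    refine hab.trans ?_
    rw [← hy b hbB]
    simpa [hbn] using real_inner_le_norm y b
  rcases (norm_nonneg y).eq_or_lt with hy0 | hy0
  · rw [← hy0] at h2
    exact h2.trans (h'.inner_nonneg i)
  · exact h2.trans (by nlinarith)

/-- The angles between principal vectors do not depend on the choice of principal vectors. -/
theorem inner_unique [FiniteDimensional ℝ B] {p' q' : Fin m → E}
    (h : IsPrincipalVectors A B p q) (h' : IsPrincipalVectors A B p' q') (i : Fin m) :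
    ⟪p i, q i⟫ = ⟪p' i, q' i⟫ :=
  le_antisymm (h.inner_le_inner h' i) (h'.inner_le_inner h i)

end IsPrincipalVectors

end Principal

/-! ### The Grassmannian and its distance -/

/-- The Grassmannian `Gr(k, n)` of `k`-dimensional linear subspaces of `ℝⁿ`. -/
abbrev Gr (k n : ℕ) : Type :=
  {A : Submodule ℝ (EuclideanSpace ℝ (Fin n)) // Module.finrank ℝ A = k}

theorem Gr.exists_principal {k n : ℕ} (A B : Gr k n) :
    ∃ pq : (Fin k → EuclideanSpace ℝ (Fin n)) × (Fin k → EuclideanSpace ℝ (Fin n)),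
      IsPrincipalVectors A.1 B.1 pq.1 pq.2 := by
  obtain ⟨p, q, h⟩ := exists_isPrincipalVectors A.1 B.1 k A.2.ge B.2.ge
  exact ⟨(p, q), h⟩

/-- The `i`-th principal angle between two `k`-planes: the angle between the vectors of the `i`-th
pair of principal vectors (it does not depend on which principal vectors are chosen, see
`principalAngle_eq`). -/
noncomputable def principalAngle {k n : ℕ} (A B : Gr k n) (i : Fin k) : ℝ :=
  InnerProductGeometry.angle ((Gr.exists_principal A B).choose.1 i)
    ((Gr.exists_principal A B).choose.2 i)

theorem principalAngle_eq {k n : ℕ} (A B : Gr k n) {p q : Fin k → EuclideanSpace ℝ (Fin n)}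
    (h : IsPrincipalVectors A.1 B.1 p q) (i : Fin k) :
    principalAngle A B i = InnerProductGeometry.angle (p i) (q i) := by
  have h' := (Gr.exists_principal A B).choose_spec
  rw [principalAngle, InnerProductGeometry.angle, InnerProductGeometry.angle, h.left_norm,
    h.right_norm, h'.left_norm, h'.right_norm, h'.inner_unique h]

/-- The Grassmann distance on `Gr(k, n)`: the `ℓ²`-norm of the vector of principal angles. -/
noncomputable def grDist {k n : ℕ} (A B : Gr k n) : ℝ :=
  √(∑ i, principalAngle A B i ^ 2)

/-! ### The affine Grassmannian and its embedding -/

/-- `Graff(k, n)`: the set of `k`-dimensional affine subspaces of `ℝⁿ`. -/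
abbrev Graff (k n : ℕ) : Type :=
  {S : AffineSubspace ℝ (EuclideanSpace ℝ (Fin n)) //
    (S : Set (EuclideanSpace ℝ (Fin n))).Nonempty ∧ Module.finrank ℝ S.direction = k}

/-- A linear `k`-plane regarded as a `k`-flat (through the origin). -/
def Gr.toGraff {k n : ℕ} (A : Gr k n) : Graff k n :=
  ⟨A.1.toAffineSubspace, ⟨0, A.1.zero_mem⟩, by
    rw [Submodule.toAffineSubspace_direction]; exact A.2⟩

/-- The inclusion `ℝⁿ → ℝⁿ⁺¹`, `x ↦ (x, 0)`. -/
def incl (n : ℕ) : EuclideanSpace ℝ (Fin n) →ₗ[ℝ] EuclideanSpace ℝ (Fin (n + 1)) where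
  toFun x := WithLp.toLp 2 (Fin.snoc (α := fun _ => ℝ) x.ofLp 0)
  map_add' x y := by
    ext i
    refine Fin.lastCases ?_ (fun i => ?_) i <;> simp
  map_smul' c x := by
    ext i
    refine Fin.lastCases ?_ (fun i => ?_) i <;> simp

/-- The last standard basis vector `(0, …, 0, 1)` of `ℝⁿ⁺¹`. -/
noncomputable def eLast (n : ℕ) : EuclideanSpace ℝ (Fin (n + 1)) :=
  EuclideanSpace.single (Fin.last n) 1

/-- The linear subspace `span (𝔸 ∪ {b + eₙ₊₁})` of `ℝⁿ⁺¹`. -/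
noncomputable def jSpan {n : ℕ} (A : Submodule ℝ (EuclideanSpace ℝ (Fin n)))
    (b : EuclideanSpace ℝ (Fin n)) : Submodule ℝ (EuclideanSpace ℝ (Fin (n + 1))) :=
  Submodule.span ℝ (incl n '' (A : Set (EuclideanSpace ℝ (Fin n))) ∪ {incl n b + eLast n})

theorem incl_injective (n : ℕ) : Function.Injective (incl n) := by
  intro x y h
  ext i
  have := congrArg (fun z : EuclideanSpace ℝ (Fin (n + 1)) => z i.castSucc) h
  simpa [incl] using this

theorem jSpan_eq {n : ℕ} (A : Submodule ℝ (EuclideanSpace ℝ (Fin n)))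
    (b : EuclideanSpace ℝ (Fin n)) :
    jSpan A b = A.map (incl n) ⊔ Submodule.span ℝ {incl n b + eLast n} := by
  rw [jSpan, Submodule.span_union, ← Submodule.map_span, Submodule.span_eq]

theorem finrank_jSpan {n : ℕ} (A : Submodule ℝ (EuclideanSpace ℝ (Fin n)))
    (b : EuclideanSpace ℝ (Fin n)) :
    Module.finrank ℝ (jSpan A b) = Module.finrank ℝ A + 1 := by
  have hlast : (incl n b + eLast n) (Fin.last n) = 1 := by simp [incl, eLast]
  have hne : incl n b + eLast n ≠ 0 := fun h => by
    rw [h] at hlast; simp at hlast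
  have hdisj : A.map (incl n) ⊓ Submodule.span ℝ {incl n b + eLast n} = ⊥ := by
    rw [eq_bot_iff]
    rintro x ⟨⟨a, -, rfl⟩, hx⟩
    obtain ⟨c, hc⟩ := Submodule.mem_span_singleton.1 hx
    have h1 := congrArg (fun z : EuclideanSpace ℝ (Fin (n + 1)) => z (Fin.last n)) hc
    simp only [PiLp.smul_apply, hlast] at h1
    have : c = 0 := by simpa [incl] using h1
    rw [← hc, this, zero_smul]
    exact Submodule.zero_mem _
  have h := Submodule.finrank_sup_add_finrank_inf_eq (A.map (incl n))
    (Submodule.span ℝ {incl n b + eLast n})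
  rw [hdisj, finrank_bot, add_zero, finrank_span_singleton hne,
    ← (Submodule.equivMapOfInjective (incl n) (incl_injective n) A).finrank_eq] at h
  rw [jSpan_eq, h]

/-- The embedding `j : Graff(k, n) → Gr(k+1, n+1)`, `𝔸 + b ↦ span (𝔸 ∪ {b + eₙ₊₁})`
(independent of the choice of the displacement `b`, see `j_eq`). -/
noncomputable def j {k n : ℕ} (S : Graff k n) : Gr (k + 1) (n + 1) :=
  ⟨jSpan S.1.direction S.2.1.some, by rw [finrank_jSpan, S.2.2]⟩

theorem j_eq {k n : ℕ} (S : Graff k n) (b : EuclideanSpace ℝ (Fin n)) (hb : b ∈ S.1) :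
    (j S).1 = jSpan S.1.direction b := by
  have key : ∀ c ∈ S.1, ∀ d ∈ S.1, jSpan S.1.direction c ≤ jSpan S.1.direction d := by
    intro c hc d hd
    refine Submodule.span_le.2 (Set.union_subset ?_ ?_)
    · exact Set.subset_union_left.trans Submodule.subset_span
    · rw [Set.singleton_subset_iff]
      have h : incl n c + eLast n = incl n (c - d) + (incl n d + eLast n) := by
        rw [map_sub]; abel
      rw [h]
      exact Submodule.add_mem _
        (Submodule.subset_span (Or.inl ⟨c - d, AffineSubspace.vsub_mem_direction hc hd, rfl⟩))
        (Submodule.subset_span (Or.inr rfl))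
  exact le_antisymm (key _ S.2.1.some_mem _ hb) (key _ hb _ S.2.1.some_mem)

/-- The restriction of the Grassmann distance of `Gr(k+1, n+1)` to `Graff(k, n)` through `j`. -/
noncomputable def graffDist {k n : ℕ} (S T : Graff k n) : ℝ :=
  grDist (j S) (j T)

/-! ### Stiefel coordinates -/

/-- `[A, b₀]` are orthogonal affine coordinates of the affine subspace `S`: the columns of `A` are
orthonormal, `b₀` is orthogonal to them, and `S = span(A) + b₀`. -/
structure IsOrthAffineCoords {k n : ℕ} (S : AffineSubspace ℝ (EuclideanSpace ℝ (Fin n)))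
    (A : Matrix (Fin n) (Fin k) ℝ) (b₀ : EuclideanSpace ℝ (Fin n)) : Prop where
  orthonormal : A.transpose * A = 1
  orthogonal : A.transpose.mulVec b₀.ofLp = 0
  eq_span_add : S = AffineSubspace.mk' b₀
    (Submodule.span ℝ (Set.range fun l : Fin k => WithLp.toLp 2 (A.col l)))

/-- The `(n+1) × (k+1)` matrix of Stiefel coordinates built from orthogonal affine coordinates
`[A, b₀]`. -/
noncomputable def stiefel {k n : ℕ} (A : Matrix (Fin n) (Fin k) ℝ)
    (b₀ : EuclideanSpace ℝ (Fin n)) : Matrix (Fin (n + 1)) (Fin (k + 1)) ℝ :=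
  Matrix.reindex finSumFinEquiv finSumFinEquiv
    (Matrix.fromBlocks
      A (Matrix.of fun (i : Fin n) (_ : Fin 1) => b₀ i / √(1 + ‖b₀‖ ^ 2))
      0 (Matrix.of fun (_ _ : Fin 1) => 1 / √(1 + ‖b₀‖ ^ 2)))

/-- The `i`-th largest singular value of a square real matrix. -/
noncomputable def singularValue {m : ℕ} (M : Matrix (Fin m) (Fin m) ℝ) (i : Fin m) : ℝ :=
  (Matrix.toEuclideanLin M).singularValues i

end AffineGrassmannian

/-!
The heart of the matter is the triangle inequality for the Grassmann distance. It rests on the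
convexity of two functions: `x ↦ (arccos x)²` on `[-1, 1]`, because `θ / sin θ` increases with `θ`,
and `y ↦ (arccos √y)²` on `[0, 1]`, because `2 arccos √y = arccos (2y - 1)`.

Fix subspaces `A` and `B` of dimension `m` and write `∠(x, B) = arccos ‖P_B x‖` for a unit vector
`x`. For orthonormal bases `u` and `v` of `A`, the numbers `⟪v l, u i⟫²` form a doubly stochastic
matrix. If the projections `P_B (v l)` are pairwise orthogonal, then
`‖P_B (u i)‖² = ∑ l, ⟪v l, u i⟫² ‖P_B (v l)‖²`, so Jensen's inequality for the second function gives
`∑ ∠(u i, B)² ≤ ∑ ∠(v i, B)²` (`sum_arccos_sq_le`). Two consequences follow. Every orthonormal basis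
of `A` with pairwise orthogonal projections to `B`, not only a basis of principal vectors, computes
the distance (`grDist_eq_of_isFrame`); and every orthonormal basis of `A` gives a lower bound for it
(`sqrt_sum_arccos_sq_le_grDist`).

For the triangle inequality let `u` be principal vectors of `A` with respect to `C`, and let `w` be
the image of `u` under the isometry `A → B` that maps principal vectors of the pair `(A, B)` to each
other. Then `⟪u i, w i⟫` is an average of the cosines of the principal angles of `(A, B)`, and
Jensen's inequality for the first function gives `∑ ∠(u i, w i)² ≤ d(A, B)²`
(`IsPrincipalVectors.exists_isFrame_sum_angle_sq_le`). Since `∠(u i, C) ≤ ∠(u i, w i) + ∠(w i, C)`,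
Minkowski's inequality yields `d(A, C) ≤ d(A, B) + d(B, C)` (`grDist_triangle`).

The distance on flats is the pullback of the Grassmann distance along `j`, which is injective since
a flat is the slice of its image at height one. The other two assertions are applications of
`grDist_eq_of_isFrame`: for linear subspaces, principal vectors of `A` together with the common
vector `eLast n` have pairwise orthogonal projections; for Stiefel coordinates, such a basis is given
by the right singular vectors of the matrix of inner products of two orthonormal bases
(`grDist_eq_singularValue`).
-/

namespace AffineGrassmannian

/-! ### Convexity of the squared angle -/

theorem convexOn_arccos_sq : ConvexOn ℝ (Set.Icc (-1) 1) fun x => Real.arccos x ^ 2 := by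
  have hd : ∀ x ∈ Set.Ioo (-1 : ℝ) 1, HasDerivAt (fun x => Real.arccos x ^ 2)
      (-2 * (Real.arccos x / Real.sin (Real.arccos x))) x := by
    intro x hx
    refine ((Real.hasDerivAt_arccos hx.1.ne' hx.2.ne).pow 2).congr_deriv ?_
    rw [Real.sin_arccos]
    simp only [Nat.cast_ofNat]
    ring
  refine MonotoneOn.convexOn_of_deriv (convex_Icc _ _) (by fun_prop) ?_ ?_
  · rw [interior_Icc]
    exact fun x hx => (hd x hx).differentiableAt.differentiableWithinAt
  · rw [interior_Icc]
    intro x hx y hy hxy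
    rw [(hd x hx).deriv, (hd y hy).deriv]
    have hy0 : 0 < Real.arccos y := Real.arccos_pos.2 hy.2
    have hyx : Real.arccos y ≤ Real.arccos x := Real.arccos_le_arccos hxy
    have hx0 : 0 < Real.arccos x := hy0.trans_le hyx
    have hlt : ∀ z ∈ Set.Ioo (-1 : ℝ) 1, 0 < Real.sin (Real.arccos z) := fun z hz => by
      rw [Real.sin_arccos]
      exact Real.sqrt_pos.2 (by nlinarith [hz.1, hz.2])
    -- the chord of the concave function `sin` from `0` to `arccos x`, evaluated at `arccos y`
    have hc := strictConcaveOn_sin_Icc.concaveOn.2 (Set.left_mem_Icc.2 Real.pi_pos.le)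
      (⟨hx0.le, Real.arccos_le_pi x⟩ : Real.arccos x ∈ Set.Icc 0 Real.pi)
      (sub_nonneg.2 ((div_le_one hx0).2 hyx)) (by positivity : 0 ≤ Real.arccos y / Real.arccos x)
      (sub_add_cancel _ _)
    simp only [Real.sin_zero, smul_eq_mul, mul_zero, zero_add, div_mul_cancel₀ _ hx0.ne'] at hc
    have : Real.arccos y / Real.sin (Real.arccos y) ≤
        Real.arccos x / Real.sin (Real.arccos x) := by
      rw [div_le_div_iff₀ (hlt y hy) (hlt x hx)]
      rw [div_mul_eq_mul_div, div_le_iff₀ hx0] at hc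
      linarith
    linarith

theorem two_mul_arccos_sqrt {y : ℝ} (hy : y ∈ Set.Icc (0 : ℝ) 1) :
    2 * Real.arccos √y = Real.arccos (2 * y - 1) := by
  have h0 : Real.arccos √y ≤ Real.pi / 2 := Real.arccos_le_pi_div_two.2 (Real.sqrt_nonneg y)
  have h1 : Real.cos (2 * Real.arccos √y) = 2 * y - 1 := by
    rw [Real.cos_two_mul, Real.cos_arccos (by linarith [Real.sqrt_nonneg y])
      (Real.sqrt_le_one.2 hy.2), Real.sq_sqrt hy.1]
  rw [← h1, Real.arccos_cos (by linarith [Real.arccos_nonneg √y]) (by linarith)]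

theorem convexOn_arccos_sqrt_sq : ConvexOn ℝ (Set.Icc 0 1) fun y => Real.arccos √y ^ 2 := by
  refine ⟨convex_Icc _ _, fun x hx y hy a b ha hb hab => ?_⟩
  have hxy := convex_Icc (0 : ℝ) 1 hx hy ha hb hab
  have hmem : ∀ {z : ℝ}, z ∈ Set.Icc (0 : ℝ) 1 → 2 * z - 1 ∈ Set.Icc (-1 : ℝ) 1 :=
    fun hz => ⟨by linarith [hz.1], by linarith [hz.2]⟩
  have h := convexOn_arccos_sq.2 (hmem hx) (hmem hy) ha hb hab
  have hz : a • (2 * x - 1) + b • (2 * y - 1) = 2 * (a • x + b • y) - 1 := by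
    simp only [smul_eq_mul]
    linear_combination -hab
  simp only [hz, ← two_mul_arccos_sqrt hx, ← two_mul_arccos_sqrt hy,
    ← two_mul_arccos_sqrt hxy] at h
  simp only [smul_eq_mul] at h ⊢
  linarith

/-! ### Orthonormal frames and angles to a subspace -/

section Frames

variable {E : Type*} [NormedAddCommGroup E] [InnerProductSpace ℝ E]

/-- `v` is an orthonormal basis of the `m`-dimensional subspace `A`, given by vectors of the
ambient space. -/
structure IsFrame (A : Submodule ℝ E) {m : ℕ} (v : Fin m → E) : Prop where
  finrank_eq : Module.finrank ℝ A = m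
  orthonormal : Orthonormal ℝ v
  mem : ∀ i, v i ∈ A

namespace IsFrame

variable {A : Submodule ℝ E} {m : ℕ} {v u : Fin m → E}

theorem span_eq [FiniteDimensional ℝ A] (hv : IsFrame A v) :
    Submodule.span ℝ (Set.range v) = A := by
  refine Submodule.eq_of_le_of_finrank_eq (Submodule.span_le.2 ?_) ?_
  · rintro _ ⟨i, rfl⟩
    exact hv.mem i
  · rw [finrank_span_eq_card hv.orthonormal.linearIndependent, hv.finrank_eq, Fintype.card_fin]

theorem sum_inner_smul [FiniteDimensional ℝ A] (hv : IsFrame A v) {x : E} (hx : x ∈ A) :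
    ∑ i, ⟪v i, x⟫ • v i = x := by
  rw [← hv.span_eq] at hx
  obtain ⟨c, rfl⟩ := (Submodule.mem_span_range_iff_exists_fun ℝ).1 hx
  simp only [hv.orthonormal.inner_right_fintype]

theorem inner_eq_sum [FiniteDimensional ℝ A] (hv : IsFrame A v) {x : E} (hx : x ∈ A) (y : E) :
    ⟪x, y⟫ = ∑ i, ⟪v i, x⟫ * ⟪v i, y⟫ := by
  conv_lhs => rw [← hv.sum_inner_smul hx]
  simp only [sum_inner, real_inner_smul_left]

theorem sum_inner_sq [FiniteDimensional ℝ A] (hv : IsFrame A v) {x : E} (hx : x ∈ A) :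
    ∑ i, ⟪v i, x⟫ ^ 2 = ‖x‖ ^ 2 := by
  rw [← real_inner_self_eq_norm_sq, hv.inner_eq_sum hx]
  simp only [sq]

theorem starProjection_eq_sum [FiniteDimensional ℝ A] (hv : IsFrame A v) (x : E) :
    A.starProjection x = ∑ i, ⟪v i, x⟫ • v i := by
  rw [← hv.sum_inner_smul (A.starProjection_apply_mem x)]
  refine Finset.sum_congr rfl fun i _ => ?_
  rw [← A.inner_starProjection_left_eq_right,
    Submodule.starProjection_eq_self_iff.2 (hv.mem i)]

theorem inner_starProjection [FiniteDimensional ℝ A] (hv : IsFrame A v) (x y : E) :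
    ⟪A.starProjection x, A.starProjection y⟫ = ∑ i, ⟪v i, x⟫ * ⟪v i, y⟫ := by
  rw [hv.starProjection_eq_sum x, hv.starProjection_eq_sum y, hv.orthonormal.inner_sum]
  simp

/-- The squared inner products of two orthonormal bases of the same space form a doubly
stochastic matrix, and averaging with it decreases the sum of a convex function. -/
theorem sum_convex_le [FiniteDimensional ℝ A] (hu : IsFrame A u) (hv : IsFrame A v) {s : Set ℝ}
    {f : ℝ → ℝ} (hf : ConvexOn ℝ s f) {y : Fin m → ℝ} (hy : ∀ l, y l ∈ s) :
    ∑ i, f (∑ l, ⟪v l, u i⟫ ^ 2 * y l) ≤ ∑ l, f (y l) := by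
  calc ∑ i, f (∑ l, ⟪v l, u i⟫ ^ 2 * y l)
      ≤ ∑ i, ∑ l, ⟪v l, u i⟫ ^ 2 * f (y l) := by
        refine Finset.sum_le_sum fun i _ => ?_
        refine hf.map_sum_le (fun l _ => sq_nonneg _) ?_ fun l _ => hy l
        rw [hv.sum_inner_sq (hu.mem i), hu.orthonormal.1 i, one_pow]
    _ = ∑ l, f (y l) := by
        rw [Finset.sum_comm]
        refine Finset.sum_congr rfl fun l _ => ?_
        rw [← Finset.sum_mul]
        have := hu.sum_inner_sq (hv.mem l)
        rw [hv.orthonormal.1 l, one_pow] at this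
        simp only [real_inner_comm (u _) (v l)] at this ⊢
        rw [this, one_mul]

end IsFrame

variable {A B : Submodule ℝ E} {m : ℕ} {v u : Fin m → E}

theorem norm_starProjection_mem_Icc [B.HasOrthogonalProjection] {x : E} (hx : ‖x‖ = 1) :
    ‖B.starProjection x‖ ∈ Set.Icc (0 : ℝ) 1 :=
  ⟨norm_nonneg _, hx ▸ B.norm_starProjection_apply_le x⟩

/-- Among the orthonormal bases of `A`, one whose projections to `B` are pairwise orthogonal
maximizes the sum of the squared angles to `B`. -/
theorem sum_arccos_sq_le [FiniteDimensional ℝ A] [FiniteDimensional ℝ B] (hu : IsFrame A u)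
    (hv : IsFrame A v)
    (hdiag : Pairwise fun i l => ⟪B.starProjection (v i), B.starProjection (v l)⟫ = 0) :
    ∑ i, Real.arccos ‖B.starProjection (u i)‖ ^ 2 ≤
      ∑ i, Real.arccos ‖B.starProjection (v i)‖ ^ 2 := by
  have h := hu.sum_convex_le hv convexOn_arccos_sqrt_sq
    (y := fun l => ‖B.starProjection (v l)‖ ^ 2) fun l =>
      ⟨sq_nonneg _, pow_le_one₀ (norm_nonneg _)
        (norm_starProjection_mem_Icc (hv.orthonormal.1 l)).2⟩
  have hsum : ∀ i, ∑ l, ⟪v l, u i⟫ ^ 2 * ‖B.starProjection (v l)‖ ^ 2 =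
      ‖B.starProjection (u i)‖ ^ 2 := by
    intro i
    conv_rhs => rw [← hv.sum_inner_smul (hu.mem i), ← real_inner_self_eq_norm_sq]
    simp only [map_sum, map_smul, sum_inner, inner_sum, real_inner_smul_left,
      real_inner_smul_right]
    refine Finset.sum_congr rfl fun l _ => ?_
    rw [Finset.sum_eq_single l (fun r _ hr => by rw [hdiag hr]; simp) (by simp),
      real_inner_self_eq_norm_sq]
    ring
  simpa only [hsum, Real.sqrt_sq (norm_nonneg _)] using h

theorem sum_arccos_sq_eq [FiniteDimensional ℝ A] [FiniteDimensional ℝ B] (hu : IsFrame A u)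
    (hv : IsFrame A v)
    (hu' : Pairwise fun i l => ⟪B.starProjection (u i), B.starProjection (u l)⟫ = 0)
    (hv' : Pairwise fun i l => ⟪B.starProjection (v i), B.starProjection (v l)⟫ = 0) :
    ∑ i, Real.arccos ‖B.starProjection (u i)‖ ^ 2 =
      ∑ i, Real.arccos ‖B.starProjection (v i)‖ ^ 2 :=
  le_antisymm (sum_arccos_sq_le hu hv hv') (sum_arccos_sq_le hv hu hu')

theorem angle_starProjection [B.HasOrthogonalProjection] {x : E} (hx : ‖x‖ = 1) :
    InnerProductGeometry.angle x (B.starProjection x) = Real.arccos ‖B.starProjection x‖ := by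
  have h : ⟪x, B.starProjection x⟫ = ‖B.starProjection x‖ ^ 2 := by
    rw [← real_inner_self_eq_norm_sq, B.inner_starProjection_left_eq_right,
      Submodule.starProjection_eq_self_iff.2 (B.starProjection_apply_mem x)]
  -- if the projection vanishes, both sides are `π / 2`
  rw [InnerProductGeometry.angle, h, hx, one_mul, sq, mul_self_div_self]

theorem arccos_norm_starProjection_le_angle [B.HasOrthogonalProjection] {x c : E}
    (hx : ‖x‖ = 1) (hc : c ∈ B) :
    Real.arccos ‖B.starProjection x‖ ≤ InnerProductGeometry.angle x c := by
  rw [InnerProductGeometry.angle, hx, one_mul]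
  refine Real.arccos_le_arccos (div_le_of_le_mul₀ (norm_nonneg _) (norm_nonneg _) ?_)
  have h := real_inner_le_norm (B.starProjection x) c
  rwa [B.inner_starProjection_left_eq_right, Submodule.starProjection_eq_self_iff.2 hc] at h

theorem arccos_norm_starProjection_le_add [B.HasOrthogonalProjection] {x y : E}
    (hx : ‖x‖ = 1) (hy : ‖y‖ = 1) :
    Real.arccos ‖B.starProjection x‖ ≤
      InnerProductGeometry.angle x y + Real.arccos ‖B.starProjection y‖ := by
  rw [← angle_starProjection hy]
  exact (arccos_norm_starProjection_le_angle hx (B.starProjection_apply_mem y)).trans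
    (InnerProductGeometry.angle_le_angle_add_angle _ _ _)

namespace IsPrincipalVectors

variable {p q : Fin m → E}

theorem isFrame_left (h : IsPrincipalVectors A B p q) (hA : Module.finrank ℝ A = m) :
    IsFrame A p :=
  ⟨hA, h.orthonormal_left, h.left_mem⟩

theorem isFrame_right (h : IsPrincipalVectors A B p q) (hB : Module.finrank ℝ B = m) :
    IsFrame B q :=
  h.symm.isFrame_left hB

theorem starProjection_left [FiniteDimensional ℝ B] (h : IsPrincipalVectors A B p q)
    (hB : Module.finrank ℝ B = m) (i : Fin m) :
    B.starProjection (p i) = ⟪p i, q i⟫ • q i := by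
  rw [(h.isFrame_right hB).starProjection_eq_sum, Finset.sum_eq_single i
    (fun l _ hl => by rw [real_inner_comm, h.inner_cross hl.symm, zero_smul]) (by simp),
    real_inner_comm]

theorem pairwise_inner_starProjection [FiniteDimensional ℝ B] (h : IsPrincipalVectors A B p q)
    (hB : Module.finrank ℝ B = m) :
    Pairwise fun i l => ⟪B.starProjection (p i), B.starProjection (p l)⟫ = 0 := by
  intro i l hil
  rw [h.starProjection_left hB, h.starProjection_left hB, real_inner_smul_left,
    real_inner_smul_right, h.symm.orthonormal_left.2 hil, mul_zero, mul_zero]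

theorem angle_eq (h : IsPrincipalVectors A B p q) (i : Fin m) :
    InnerProductGeometry.angle (p i) (q i) = Real.arccos ⟪p i, q i⟫ := by
  rw [InnerProductGeometry.angle, h.left_norm, h.right_norm, one_mul, div_one]

theorem norm_starProjection_left [FiniteDimensional ℝ B] (h : IsPrincipalVectors A B p q)
    (hB : Module.finrank ℝ B = m) (i : Fin m) :
    ‖B.starProjection (p i)‖ = ⟪p i, q i⟫ := by
  rw [h.starProjection_left hB, norm_smul, h.right_norm, mul_one,
    Real.norm_of_nonneg (h.inner_nonneg i)]

/-- The isometry of `A` onto `B` which maps principal vectors to principal vectors moves an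
orthonormal basis `u` of `A` to an orthonormal basis `w` of `B`, and the sum of the squared angles
between corresponding vectors of `u` and `w` is at most that for the principal vectors. -/
theorem exists_isFrame_sum_angle_sq_le [FiniteDimensional ℝ A] [FiniteDimensional ℝ B]
    (h : IsPrincipalVectors A B p q) (hA : Module.finrank ℝ A = m)
    (hB : Module.finrank ℝ B = m) (hu : IsFrame A u) :
    ∃ w : Fin m → E, IsFrame B w ∧ ∑ i, InnerProductGeometry.angle (u i) (w i) ^ 2 ≤
      ∑ i, InnerProductGeometry.angle (p i) (q i) ^ 2 := by
  have hp := h.isFrame_left hA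
  have hq := h.isFrame_right hB
  let w : Fin m → E := fun i => ∑ l, ⟪p l, u i⟫ • q l
  have hw : ∀ i l, ⟪w i, w l⟫ = ⟪u i, u l⟫ := fun i l => by
    rw [hp.inner_eq_sum (hu.mem i)]
    simp only [w, hq.orthonormal.inner_sum]
    simp
  have hwn : ∀ i, ‖w i‖ = 1 := fun i => by
    rw [← hu.orthonormal.1 i, norm_eq_sqrt_real_inner, norm_eq_sqrt_real_inner, hw]
  have hwf : IsFrame B w :=
    ⟨hB, ⟨hwn, fun i l hil => (hw i l).trans (hu.orthonormal.2 hil)⟩,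
      fun i => B.sum_mem fun l _ => B.smul_mem _ (h.right_mem l)⟩
  have hcross : ∀ i l, ⟪u i, q l⟫ = ⟪p l, u i⟫ * ⟪p l, q l⟫ := fun i l => by
    rw [hp.inner_eq_sum (hu.mem i), Finset.sum_eq_single l
      (fun r _ hr => by rw [h.inner_cross hr, mul_zero]) (by simp)]
  have hangle : ∀ i, InnerProductGeometry.angle (u i) (w i) =
      Real.arccos (∑ l, ⟪p l, u i⟫ ^ 2 * ⟪p l, q l⟫) := fun i => by
    rw [InnerProductGeometry.angle, hu.orthonormal.1 i, hwn, one_mul, div_one]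
    simp only [w, inner_sum, real_inner_smul_right, hcross]
    congr 1
    exact Finset.sum_congr rfl fun l _ => by ring
  refine ⟨w, hwf, ?_⟩
  simp only [hangle, h.angle_eq]
  refine hu.sum_convex_le hp convexOn_arccos_sq fun l => ⟨?_, ?_⟩
  · linarith [h.inner_nonneg l]
  · simpa [h.left_norm, h.right_norm] using real_inner_le_norm (p l) (q l)

end IsPrincipalVectors

end Frames

/-! ### The Grassmann distance -/

section GrDist

variable {k n : ℕ}

theorem sqrt_sum_add_sq_le {m : ℕ} (a b : Fin m → ℝ) :
    √(∑ i, (a i + b i) ^ 2) ≤ √(∑ i, a i ^ 2) + √(∑ i, b i ^ 2) := by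
  have h := norm_add_le (WithLp.toLp 2 a) (WithLp.toLp 2 b)
  simpa only [EuclideanSpace.norm_eq, PiLp.add_apply, Real.norm_eq_abs, sq_abs] using h

/-- The Grassmann distance can be computed from any orthonormal basis of `A` whose projections to
`B` are pairwise orthogonal. -/
theorem grDist_eq_of_isFrame (A B : Gr k n) {v : Fin k → EuclideanSpace ℝ (Fin n)}
    (hv : IsFrame A.1 v)
    (hdiag : Pairwise fun i l => ⟪B.1.starProjection (v i), B.1.starProjection (v l)⟫ = 0) :
    grDist A B = √(∑ i, Real.arccos ‖B.1.starProjection (v i)‖ ^ 2) := by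
  obtain ⟨⟨p, q⟩, h⟩ := Gr.exists_principal A B
  rw [grDist, sum_arccos_sq_eq hv (h.isFrame_left A.2) hdiag
    (h.pairwise_inner_starProjection B.2)]
  simp only [principalAngle_eq A B h, h.angle_eq, h.norm_starProjection_left B.2]

theorem sqrt_sum_arccos_sq_le_grDist (A B : Gr k n) {u : Fin k → EuclideanSpace ℝ (Fin n)}
    (hu : IsFrame A.1 u) :
    √(∑ i, Real.arccos ‖B.1.starProjection (u i)‖ ^ 2) ≤ grDist A B := by
  obtain ⟨⟨p, q⟩, h⟩ := Gr.exists_principal A B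
  have hdiag := h.pairwise_inner_starProjection B.2
  rw [grDist_eq_of_isFrame A B (h.isFrame_left A.2) hdiag]
  exact Real.sqrt_le_sqrt (sum_arccos_sq_le hu (h.isFrame_left A.2) hdiag)

theorem grDist_comm (A B : Gr k n) : grDist A B = grDist B A := by
  obtain ⟨⟨p, q⟩, h⟩ := Gr.exists_principal A B
  simp only [grDist, principalAngle_eq A B h, principalAngle_eq B A h.symm,
    InnerProductGeometry.angle_comm (p _)]

theorem grDist_self (A : Gr k n) : grDist A A = 0 := by
  obtain ⟨⟨p, q⟩, h⟩ := Gr.exists_principal A A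
  have hp : ∀ i, A.1.starProjection (p i) = p i := fun i =>
    Submodule.starProjection_eq_self_iff.2 (h.left_mem i)
  rw [grDist_eq_of_isFrame A A (h.isFrame_left A.2) (h.pairwise_inner_starProjection A.2)]
  simp [hp, h.left_norm]

theorem eq_of_grDist_eq_zero {A B : Gr k n} (hAB : grDist A B = 0) : A = B := by
  obtain ⟨⟨p, q⟩, h⟩ := Gr.exists_principal A B
  simp only [grDist, principalAngle_eq A B h] at hAB
  rw [Real.sqrt_eq_zero (Finset.sum_nonneg fun i _ => sq_nonneg _),
    Finset.sum_eq_zero_iff_of_nonneg fun i _ => sq_nonneg _] at hAB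
  have hpq : p = q := by
    funext i
    have hi := pow_eq_zero_iff two_ne_zero |>.1 (hAB i (Finset.mem_univ i))
    refine (inner_eq_one_iff_of_norm_eq_one (𝕜 := ℝ) (h.left_norm i) (h.right_norm i)).1 ?_
    rw [InnerProductGeometry.inner_eq_cos_angle_of_norm_eq_one (h.left_norm i) (h.right_norm i),
      hi, Real.cos_zero]
  ext1
  rw [← (h.isFrame_left A.2).span_eq, ← (h.isFrame_right B.2).span_eq, hpq]

/-- Carry an orthonormal basis `u` of `A` that computes `grDist A C` over to an orthonormal basis
`w` of `B`; the triangle inequality for the angles of the vectors `u i` and `w i` to `C` and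
Minkowski's inequality then bound `grDist A C`. -/
theorem grDist_triangle (A B C : Gr k n) : grDist A C ≤ grDist A B + grDist B C := by
  obtain ⟨⟨u, v⟩, hAC⟩ := Gr.exists_principal A C
  obtain ⟨⟨p, q⟩, hAB⟩ := Gr.exists_principal A B
  have hu := hAC.isFrame_left A.2
  obtain ⟨w, hw, hle⟩ := hAB.exists_isFrame_sum_angle_sq_le A.2 B.2 hu
  rw [grDist_eq_of_isFrame A C hu (hAC.pairwise_inner_starProjection C.2)]
  calc √(∑ i, Real.arccos ‖C.1.starProjection (u i)‖ ^ 2)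
      ≤ √(∑ i, (InnerProductGeometry.angle (u i) (w i) +
          Real.arccos ‖C.1.starProjection (w i)‖) ^ 2) := by
        refine Real.sqrt_le_sqrt (Finset.sum_le_sum fun i _ => ?_)
        exact pow_le_pow_left₀ (Real.arccos_nonneg _)
          (arccos_norm_starProjection_le_add (hu.orthonormal.1 i) (hw.orthonormal.1 i)) 2
    _ ≤ √(∑ i, InnerProductGeometry.angle (u i) (w i) ^ 2) +
          √(∑ i, Real.arccos ‖C.1.starProjection (w i)‖ ^ 2) := sqrt_sum_add_sq_le _ _
    _ ≤ grDist A B + grDist B C := by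
        refine add_le_add ?_ (sqrt_sum_arccos_sq_le_grDist B C hw)
        simp only [grDist, principalAngle_eq A B hAB]
        exact Real.sqrt_le_sqrt hle

/-- If `y` and `z` are orthonormal bases of `A` and `B`, the principal angles between `A` and `B`
are the arccosines of the singular values of the matrix of inner products `⟪y l, z i⟫`. -/
theorem grDist_eq_singularValue (A B : Gr k n) {y z : Fin k → EuclideanSpace ℝ (Fin n)}
    (hy : IsFrame A.1 y) (hz : IsFrame B.1 z) {M : Matrix (Fin k) (Fin k) ℝ}
    (hM : ∀ l i, M l i = ⟪y l, z i⟫) :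
    grDist A B = √(∑ i, Real.arccos (singularValue M i) ^ 2) := by
  let T := Matrix.toEuclideanLin M
  have hS := T.isSymmetric_adjoint_comp_self
  have hfin : Module.finrank ℝ (EuclideanSpace ℝ (Fin k)) = k := finrank_euclideanSpace_fin
  let e := hS.eigenvectorBasis hfin
  -- the right singular vectors of `M`, as vectors of `B`
  let v : Fin k → EuclideanSpace ℝ (Fin n) := fun i => ∑ r, e i r • z r
  have hTv : ∀ i l, ⟪y l, v i⟫ = T (e i) l := fun i l => by
    simp only [v, T, inner_sum, real_inner_smul_right, Matrix.ofLp_toLpLin,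
      Matrix.toLin'_apply, Matrix.mulVec, dotProduct, hM]
    exact Finset.sum_congr rfl fun r _ => mul_comm _ _
  have hvv : ∀ i l, ⟪v i, v l⟫ = ⟪e i, e l⟫ := fun i l => by
    simp only [v, hz.orthonormal.inner_sum, PiLp.inner_apply]
    exact Finset.sum_congr rfl fun r _ => mul_comm _ _
  have hv : IsFrame B.1 v := by
    refine ⟨B.2, ⟨fun i => ?_, fun i l hil => (hvv i l).trans (e.orthonormal.2 hil)⟩,
      fun i => B.1.sum_mem fun r _ => B.1.smul_mem _ (hz.mem r)⟩
    rw [← e.orthonormal.1 i, norm_eq_sqrt_real_inner, norm_eq_sqrt_real_inner, hvv]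
  have hP : ∀ i l, ⟪A.1.starProjection (v i), A.1.starProjection (v l)⟫ =
      singularValue M l ^ 2 * ⟪e i, e l⟫ := fun i l => by
    have h1 : ⟪A.1.starProjection (v i), A.1.starProjection (v l)⟫ = ⟪T (e i), T (e l)⟫ := by
      rw [hy.inner_starProjection]
      simp only [hTv, PiLp.inner_apply]
      exact Finset.sum_congr rfl fun r _ => mul_comm _ _
    have h2 : T.adjoint (T (e l)) = (singularValue M l ^ 2) • e l := by
      rw [singularValue, T.sq_singularValues_fin hfin]
      exact hS.apply_eigenvectorBasis hfin l
    rw [h1, ← LinearMap.adjoint_inner_right, h2, real_inner_smul_right]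
  have hnorm : ∀ i, ‖A.1.starProjection (v i)‖ = singularValue M i := fun i => by
    refine (sq_eq_sq₀ (norm_nonneg _) (T.singularValues_nonneg i)).1 ?_
    rw [← real_inner_self_eq_norm_sq, hP, real_inner_self_eq_norm_sq, e.orthonormal.1 i]
    simp [singularValue, T]
  rw [grDist_comm, grDist_eq_of_isFrame B A hv fun i l hil =>
    (hP i l).trans (by rw [e.orthonormal.2 hil, mul_zero])]
  simp only [hnorm]

end GrDist

/-! ### The embedding of the affine Grassmannian -/

section Embedding

variable {k n : ℕ}

@[simp]
theorem incl_castSucc (x : EuclideanSpace ℝ (Fin n)) (i : Fin n) : incl n x i.castSucc = x i := by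
  simp [incl]

@[simp]
theorem incl_last (x : EuclideanSpace ℝ (Fin n)) : incl n x (Fin.last n) = 0 := by
  simp [incl]

@[simp]
theorem eLast_castSucc (i : Fin n) : eLast n i.castSucc = 0 := by
  simp [eLast, i.castSucc_lt_last.ne]

@[simp]
theorem eLast_last : eLast n (Fin.last n) = 1 := by
  simp [eLast]

@[simp]
theorem inner_incl_incl (x y : EuclideanSpace ℝ (Fin n)) : ⟪incl n x, incl n y⟫ = ⟪x, y⟫ := by
  simp [PiLp.inner_apply, Fin.sum_univ_castSucc]

@[simp]
theorem inner_incl_eLast (x : EuclideanSpace ℝ (Fin n)) : ⟪incl n x, eLast n⟫ = 0 := by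
  simp [PiLp.inner_apply, Fin.sum_univ_castSucc]

@[simp]
theorem inner_eLast_incl (x : EuclideanSpace ℝ (Fin n)) : ⟪eLast n, incl n x⟫ = 0 := by
  rw [real_inner_comm, inner_incl_eLast]

@[simp]
theorem norm_incl (x : EuclideanSpace ℝ (Fin n)) : ‖incl n x‖ = ‖x‖ := by
  rw [norm_eq_sqrt_real_inner, norm_eq_sqrt_real_inner, inner_incl_incl]

@[simp]
theorem norm_eLast : ‖eLast n‖ = 1 := by
  simp [eLast]

/-- The flat is recovered from its image under `j` as the slice at height one. -/
theorem incl_add_eLast_mem_j_iff (S : Graff k n) (x : EuclideanSpace ℝ (Fin n)) :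
    incl n x + eLast n ∈ (j S).1 ↔ x ∈ S.1 := by
  refine ⟨fun hx => ?_, fun hx => ?_⟩
  · obtain ⟨b, hb⟩ := S.2.1
    rw [j_eq S b hb, jSpan_eq, Submodule.mem_sup] at hx
    obtain ⟨_, ⟨a, ha, rfl⟩, _, hc, h⟩ := hx
    obtain ⟨c, rfl⟩ := Submodule.mem_span_singleton.1 hc
    have hc1 := congrArg (fun z : EuclideanSpace ℝ (Fin (n + 1)) => z (Fin.last n)) h
    simp only [PiLp.add_apply, PiLp.smul_apply, incl_last, eLast_last, zero_add, smul_eq_mul,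
      mul_one] at hc1
    rw [hc1, one_smul, ← add_assoc, add_left_inj, ← map_add] at h
    rw [← incl_injective n h]
    exact AffineSubspace.vadd_mem_of_mem_direction ha hb
  · rw [j_eq S x hx]
    exact Submodule.subset_span (Or.inr rfl)

theorem j_injective : Function.Injective (j : Graff k n → Gr (k + 1) (n + 1)) := by
  intro S T h
  ext x
  rw [← incl_add_eLast_mem_j_iff, h, incl_add_eLast_mem_j_iff]

theorem incl_mem_j (S : Graff k n) {x : EuclideanSpace ℝ (Fin n)} (hx : x ∈ S.1.direction) :
    incl n x ∈ (j S).1 :=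
  Submodule.subset_span (Or.inl ⟨x, hx, rfl⟩)

theorem j_toGraff (A : Gr k n) :
    (j A.toGraff).1 = A.1.map (incl n) ⊔ Submodule.span ℝ {eLast n} := by
  rw [j_eq A.toGraff 0 A.1.zero_mem, jSpan_eq, map_zero, zero_add]
  congr 2
  exact Submodule.toAffineSubspace_direction A.1

theorem eLast_mem_j_toGraff (A : Gr k n) : eLast n ∈ (j A.toGraff).1 := by
  rw [j_toGraff]
  exact Submodule.mem_sup_right (Submodule.mem_span_singleton_self _)

theorem starProjection_j_toGraff_incl (B : Gr k n) (x : EuclideanSpace ℝ (Fin n)) :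
    (j B.toGraff).1.starProjection (incl n x) = incl n (B.1.starProjection x) := by
  refine Submodule.eq_starProjection_of_mem_of_inner_eq_zero ?_ fun w hw => ?_
  · rw [j_toGraff]
    exact Submodule.mem_sup_left ⟨_, B.1.starProjection_apply_mem x, rfl⟩
  · rw [j_toGraff, Submodule.mem_sup] at hw
    obtain ⟨_, ⟨b, hb, rfl⟩, _, hc, rfl⟩ := hw
    obtain ⟨c, rfl⟩ := Submodule.mem_span_singleton.1 hc
    rw [← map_sub, inner_add_right, real_inner_smul_right, inner_incl_incl, inner_incl_eLast,
      B.1.starProjection_inner_eq_zero x b hb, mul_zero, add_zero]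

/-- The subspaces `j A` and `j B` share the unit vector `eLast n`, which adds a principal angle
zero to the principal angles between `A` and `B`. -/
theorem graffDist_toGraff (A B : Gr k n) : graffDist A.toGraff B.toGraff = grDist A B := by
  obtain ⟨⟨p, q⟩, h⟩ := Gr.exists_principal A B
  have hp := h.isFrame_left A.2
  have hdiag := h.pairwise_inner_starProjection B.2
  let v : Fin (k + 1) → EuclideanSpace ℝ (Fin (n + 1)) :=
    Fin.snoc (α := fun _ => EuclideanSpace ℝ (Fin (n + 1))) (fun i => incl n (p i)) (eLast n)
  have hvc : ∀ i : Fin k, v i.castSucc = incl n (p i) := fun i => by simp [v]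
  have hvl : v (Fin.last k) = eLast n := by simp [v]
  have hPc : ∀ i : Fin k, (j B.toGraff).1.starProjection (v i.castSucc) =
      incl n (B.1.starProjection (p i)) := fun i => by
    rw [hvc, starProjection_j_toGraff_incl]
  have hPl : (j B.toGraff).1.starProjection (v (Fin.last k)) = eLast n := by
    rw [hvl, Submodule.starProjection_eq_self_iff.2 (eLast_mem_j_toGraff B)]
  have hv : IsFrame (j A.toGraff).1 v := by
    refine ⟨(j A.toGraff).2, ⟨fun i => ?_, fun i l hil => ?_⟩, fun i => ?_⟩
    · induction i using Fin.lastCases with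
      | last => rw [hvl, norm_eLast]
      | cast i => rw [hvc, norm_incl, h.left_norm]
    · change ⟪v i, v l⟫ = 0
      induction i using Fin.lastCases with
      | last =>
        induction l using Fin.lastCases with
        | last => exact absurd rfl hil
        | cast l => rw [hvl, hvc, inner_eLast_incl]
      | cast i =>
        induction l using Fin.lastCases with
        | last => rw [hvl, hvc, inner_incl_eLast]
        | cast l =>
          rw [hvc, hvc, inner_incl_incl]
          exact hp.orthonormal.2 fun hh => hil (congrArg _ hh)
    · induction i using Fin.lastCases with
      | last => rw [hvl]; exact eLast_mem_j_toGraff A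
      | cast i =>
        rw [hvc, j_toGraff]
        exact Submodule.mem_sup_left ⟨_, h.left_mem i, rfl⟩
  rw [graffDist, grDist_eq_of_isFrame _ _ hv, grDist_eq_of_isFrame A B hp hdiag,
    Fin.sum_univ_castSucc]
  · simp only [hPc, hPl, norm_incl, norm_eLast, Real.arccos_one]
    simp
  · intro i l hil
    induction i using Fin.lastCases with
    | last =>
      induction l using Fin.lastCases with
      | last => exact absurd rfl hil
      | cast l => rw [hPl, hPc, inner_eLast_incl]
    | cast i =>
      induction l using Fin.lastCases with
      | last => rw [hPl, hPc, inner_incl_eLast]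
      | cast l =>
        rw [hPc, hPc, inner_incl_incl]
        exact hdiag fun hh => hil (congrArg _ hh)

end Embedding

/-! ### Stiefel coordinates -/

section Stiefel

variable {k n : ℕ} {A : Matrix (Fin n) (Fin k) ℝ} {b₀ : EuclideanSpace ℝ (Fin n)}

theorem col_stiefel_castSucc (A : Matrix (Fin n) (Fin k) ℝ) (b₀ : EuclideanSpace ℝ (Fin n))
    (l : Fin k) :
    WithLp.toLp 2 ((stiefel A b₀).col l.castSucc) = incl n (WithLp.toLp 2 (A.col l)) := by
  ext i
  induction i using Fin.lastCases <;> simp [stiefel, Matrix.col]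

theorem col_stiefel_last (A : Matrix (Fin n) (Fin k) ℝ) (b₀ : EuclideanSpace ℝ (Fin n)) :
    WithLp.toLp 2 ((stiefel A b₀).col (Fin.last k)) =
      (√(1 + ‖b₀‖ ^ 2))⁻¹ • (incl n b₀ + eLast n) := by
  ext i
  induction i using Fin.lastCases <;> simp [stiefel, Matrix.col, div_eq_inv_mul]

/-- The columns of the matrix of Stiefel coordinates of a flat `S` are an orthonormal basis of
`j S`. -/
theorem IsOrthAffineCoords.isFrame_stiefel {S : Graff k n} (h : IsOrthAffineCoords S.1 A b₀) :
    IsFrame (j S).1 fun l => WithLp.toLp 2 ((stiefel A b₀).col l) := by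
  have hdir : S.1.direction =
      Submodule.span ℝ (Set.range fun l : Fin k => WithLp.toLp 2 (A.col l)) := by
    rw [h.eq_span_add, AffineSubspace.direction_mk']
  have hb : b₀ ∈ S.1 := by
    rw [h.eq_span_add]
    exact AffineSubspace.self_mem_mk' _ _
  have hAA : ∀ i l, ⟪WithLp.toLp 2 (A.col i), WithLp.toLp 2 (A.col l)⟫ =
      (1 : Matrix (Fin k) (Fin k) ℝ) i l := fun i l => by
    rw [← h.orthonormal]
    simp [PiLp.inner_apply, Matrix.mul_apply, Matrix.col, mul_comm]
  have hAb : ∀ i, ⟪WithLp.toLp 2 (A.col i), b₀⟫ = 0 := fun i => by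
    have := congrFun h.orthogonal i
    simpa [PiLp.inner_apply, Matrix.mulVec, dotProduct, Matrix.col, mul_comm] using this
  have hbb : ‖incl n b₀ + eLast n‖ = √(1 + ‖b₀‖ ^ 2) := by
    rw [← Real.sqrt_sq (norm_nonneg (incl n b₀ + eLast n)), norm_add_sq_real, inner_incl_eLast,
      norm_incl, norm_eLast]
    congr 1
    ring
  have hpos : 0 < √(1 + ‖b₀‖ ^ 2) := Real.sqrt_pos.2 (by positivity)
  refine ⟨(j S).2, ⟨fun i => ?_, fun i l hil => ?_⟩, fun i => ?_⟩
  · change ‖WithLp.toLp 2 ((stiefel A b₀).col i)‖ = 1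
    induction i using Fin.lastCases with
    | last =>
      rw [col_stiefel_last, norm_smul, hbb, norm_inv, Real.norm_of_nonneg hpos.le,
        inv_mul_cancel₀ hpos.ne']
    | cast i =>
      rw [col_stiefel_castSucc, norm_incl, norm_eq_sqrt_real_inner, hAA, Matrix.one_apply_eq,
        Real.sqrt_one]
  · change ⟪WithLp.toLp 2 ((stiefel A b₀).col i), WithLp.toLp 2 ((stiefel A b₀).col l)⟫ = 0
    induction i using Fin.lastCases with
    | last =>
      induction l using Fin.lastCases with
      | last => exact absurd rfl hil
      | cast l =>
        rw [col_stiefel_last, col_stiefel_castSucc, real_inner_smul_left, inner_add_left,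
          inner_incl_incl, inner_eLast_incl, real_inner_comm, hAb, add_zero, mul_zero]
    | cast i =>
      induction l using Fin.lastCases with
      | last =>
        rw [col_stiefel_last, col_stiefel_castSucc, real_inner_smul_right, inner_add_right,
          inner_incl_incl, inner_incl_eLast, hAb, add_zero, mul_zero]
      | cast l =>
        rw [col_stiefel_castSucc, col_stiefel_castSucc, inner_incl_incl, hAA,
          Matrix.one_apply_ne fun hh => hil (congrArg _ hh)]
  · change WithLp.toLp 2 ((stiefel A b₀).col i) ∈ (j S).1
    induction i using Fin.lastCases with
    | last =>
      rw [col_stiefel_last]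
      exact Submodule.smul_mem _ _ ((incl_add_eLast_mem_j_iff S b₀).2 hb)
    | cast i =>
      rw [col_stiefel_castSucc]
      refine incl_mem_j S ?_
      rw [hdir]
      exact Submodule.subset_span ⟨i, rfl⟩

end Stiefel

end AffineGrassmannian

theorem theorem8p1 (k n : ℕ) (hk : 0 < k) (hkn : k < n) :
    -- the restricted Grassmann distance is a distance on `Graff(k, n)`
    ((∀ S T : AffineGrassmannian.Graff k n, 0 ≤ AffineGrassmannian.graffDist S T) ∧
      (∀ S T : AffineGrassmannian.Graff k n,
        AffineGrassmannian.graffDist S T = 0 ↔ S = T) ∧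
      (∀ S T : AffineGrassmannian.Graff k n,
        AffineGrassmannian.graffDist S T = AffineGrassmannian.graffDist T S) ∧
      (∀ S T U : AffineGrassmannian.Graff k n,
        AffineGrassmannian.graffDist S U ≤
          AffineGrassmannian.graffDist S T + AffineGrassmannian.graffDist T U)) ∧
    -- it agrees with the Grassmann distance of `Gr(k, n)` on linear subspaces
    (∀ A B : AffineGrassmannian.Gr k n,
      AffineGrassmannian.graffDist A.toGraff B.toGraff = AffineGrassmannian.grDist A B) ∧
    -- it is computed by the singular values of the product of Stiefel coordinates
    (∀ (S T : AffineGrassmannian.Graff k n)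
      (A B : Matrix (Fin n) (Fin k) ℝ) (b₀ c₀ : EuclideanSpace ℝ (Fin n)),
      AffineGrassmannian.IsOrthAffineCoords S.1 A b₀ →
      AffineGrassmannian.IsOrthAffineCoords T.1 B c₀ →
      AffineGrassmannian.graffDist S T =
        √(∑ i : Fin (k + 1), Real.arccos (AffineGrassmannian.singularValue
          ((AffineGrassmannian.stiefel A b₀).transpose * AffineGrassmannian.stiefel B c₀) i)
            ^ 2)) := by
  refine ⟨⟨fun S T => Real.sqrt_nonneg _, fun S T => ⟨fun h => ?_, ?_⟩,
    fun S T => AffineGrassmannian.grDist_comm _ _,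
    fun S T U => AffineGrassmannian.grDist_triangle _ _ _⟩,
    AffineGrassmannian.graffDist_toGraff, fun S T A B b₀ c₀ hA hB => ?_⟩
  · exact AffineGrassmannian.j_injective (AffineGrassmannian.eq_of_grDist_eq_zero h)
  · rintro rfl
    exact AffineGrassmannian.grDist_self _
  · refine AffineGrassmannian.grDist_eq_singularValue _ _ hA.isFrame_stiefel hB.isFrame_stiefel
      fun l i => ?_
    simp [PiLp.inner_apply, Matrix.mul_apply, Matrix.col, mul_comm]
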